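/- Let $n$ be a positive integer and let $0<r<n$ be a real number. For $H\subset\mathbb{R}^n$ let $\mathcal{H}^r(H)$ denote its $r$-dimensional Hausdorff (outer) measure, $$\mathcal{H}^r(H)=\lim_{\delta\to0+}\inf\Big\{\sum_{k\in\omega}(\operatorname{diam}A_k)^r : H\subset\bigcup_{k\in\omega}A_k,\ \operatorname{diam}A_k\le\delta\text{ for all }k\Big\}.$$ Let $\mathcal{N}^r_n=\{H\subset\mathbb{R}^n:\mathcal{H}^r(H)=0\}$, and let $\mathcal{I}^r_{n,\sigma\text{-fin}}$ be the family of all $H\subset\mathbb{R}^n$ for which there are sets $H_k\subset\mathbb{R}^n$ ($k\in\omega$) with $\bigcup_{k}H_k=H$ and $\mathcal{H}^r(H_k)<\infty$ for every $k$. For a family $\mathcal{I}$ of subsets of a set $X$ put $$\operatorname{add}(\mathcal I)=\min\{|\mathcal F|:\mathcal F\subset\mathcal I,\ \textstyle\bigcup\mathcal F\notin\mathcal I\},\qquad \operatorname{cov}(\mathcal I)=\min\{|\mathcal F|:\mathcal F\subset\mathcal I,\ \textstyle\bigcup\mathcal F=X\},$$ $$\operatorname{non}(\mathcal I)=\min\{|A|:A\subset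 X,\ A\notin\mathcal I\},\qquad \operatorname{cof}(\mathcal I)=\min\{|\mathcal F|:\mathcal F\subset\mathcal I,\ \forall A\in\mathcal I\ \exists B\in\mathcal F\ A\subset B\}.$$ Then, in ZFC, $$\operatorname{add}(\mathcal{I}^r_{n,\sigma\text{-fin}})=\omega_1,\quad \operatorname{cov}(\mathcal{I}^r_{n,\sigma\text{-fin}})=\operatorname{cov}(\mathcal{N}^r_n),\quad \operatorname{non}(\mathcal{I}^r_{n,\sigma\text{-fin}})=\operatorname{non}(\mathcal{N}^r_n),\quad \operatorname{cof}(\mathcal{I}^r_{n,\sigma\text{-fin}})=\mathfrak{c}.$$ -/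

import Mathlib

open Set MeasureTheory
open scoped ENNReal Cardinal MeasureTheory

namespace HausdorffInvariants

/-- The additivity of `I`: the least cardinality of a family of members of `I`
whose union is not in `I`. -/
noncomputable def add {X : Type} (I : Set (Set X)) : Cardinal.{0} :=
  sInf {κ | ∃ F : Set (Set X), F ⊆ I ∧ ⋃₀ F ∉ I ∧ #F = κ}

/-- The covering number of `I`: the least cardinality of a family of members of `I`
whose union is the whole space. -/
noncomputable def cov {X : Type} (I : Set (Set X)) : Cardinal.{0} :=
  sInf {κ | ∃ F : Set (Set X), F ⊆ I ∧ ⋃₀ F = univ ∧ #F = κ}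

/-- The uniformity of `I`: the least cardinality of a set that is not in `I`. -/
noncomputable def non {X : Type} (I : Set (Set X)) : Cardinal.{0} :=
  sInf {κ | ∃ A : Set X, A ∉ I ∧ #A = κ}

/-- The cofinality of `I`: the least cardinality of a subfamily of `I` such that every member
of `I` is contained in a member of the subfamily. -/
noncomputable def cof {X : Type} (I : Set (Set X)) : Cardinal.{0} :=
  Order.cof I

/-- The sets of `r`-dimensional Hausdorff measure zero in `ℝⁿ`. The value of `μH[r]` at an arbitrary
(possibly non-measurable) set is its `r`-dimensional Hausdorff outer measure. -/
def nullIdeal (n : ℕ) (r : ℝ) : Set (Set (EuclideanSpace ℝ (Fin n))) :=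
  {H | μH[r] H = 0}

/-- The sets of `σ`-finite `r`-dimensional Hausdorff measure in `ℝⁿ`. The sets `S k` need not be
measurable. -/
def sigmaFinIdeal (n : ℕ) (r : ℝ) : Set (Set (EuclideanSpace ℝ (Fin n))) :=
  {H | ∃ S : ℕ → Set (EuclideanSpace ℝ (Fin n)), ⋃ k, S k = H ∧ ∀ k, μH[r] (S k) < ∞}

theorem nullIdeal_subset_sigmaFinIdeal (n : ℕ) (r : ℝ) :
    nullIdeal n r ⊆ sigmaFinIdeal n r := fun H hH =>
  ⟨fun _ => H, iUnion_const H, fun _ => by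
    have h : μH[r] H = 0 := hH
    rw [h]; exact ENNReal.zero_lt_top⟩

/-- Singletons are null, so the families in `cov` exist. -/
theorem singleton_mem_nullIdeal (n : ℕ) {r : ℝ} (hr : 0 < r) (x : EuclideanSpace ℝ (Fin n)) :
    {x} ∈ nullIdeal n r := by
  have := Measure.nullSingletonClass_hausdorff (X := EuclideanSpace ℝ (Fin n)) hr
  exact measure_singleton x

/-- The whole space is not in the ideals, so the sets in `non` exist. -/
theorem univ_notMem_sigmaFinIdeal {n : ℕ} {r : ℝ} (hrn : r < n) :
    univ ∉ sigmaFinIdeal n r := by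
  rintro ⟨S, hS, hfin⟩
  have h0 : ∀ k, μH[(n : ℝ)] (S k) = 0 := fun k =>
    (Measure.hausdorffMeasure_zero_or_top hrn (S k)).resolve_right (hfin k).ne
  have h1 : μH[(n : ℝ)] (univ : Set (EuclideanSpace ℝ (Fin n))) = 0 := by
    rw [← hS]; exact measure_iUnion_null h0
  have h2 : (μH[(n : ℝ)] : Measure (EuclideanSpace ℝ (Fin n))).IsAddHaarMeasure := by
    simpa using isAddHaarMeasure_hausdorffMeasure (E := EuclideanSpace ℝ (Fin n))
  exact (isOpen_univ.measure_pos (μH[(n : ℝ)]) univ_nonempty).ne' h1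

end HausdorffInvariants

/-!
Write `μ` for the `r`-dimensional Hausdorff measure on a real normed space of finite dimension
`d > r`. The restriction of `μ` to a set of `σ`-finite measure is an s-finite measure without atoms,
so it has a quasi-measure-preserving map to the `d`-dimensional Hausdorff measure, for which every
set of `σ`-finite `μ`-measure is null. If `𝓕` is an infinite cover of the space by such sets and
`f_H` is the map belonging to `H ∈ 𝓕`, then the sets `f_H⁻¹(G) ∩ H` with `G, H ∈ 𝓕` form a cover by
`μ`-null sets of the same cardinality. If `H` is a non-null set of `σ`-finite measure, then `f_H(H)`
does not have `σ`-finite measure. This gives the equalities for `cov` and `non`.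

For `add` and `cof` there are continuum many pairwise disjoint compact sets of positive finite
`μ`-measure, of which a set of `σ`-finite measure contains only countably many. They are the
self-similar Cantor sets of the points whose coordinates are `∑ aₖ sᵏ`, where the digits
`aₖ = 2 wₖ + zₖ` have `M` choices of `wₖ` in each coordinate and a bit `zₖ` that is common to all
coordinates and fixed in advance. The exponent `r` is matched by `M ^ d * s ^ r = 1`, and for large
`M` the ratio `s` is so small that distinct digit sequences give distinct points.
-/

namespace HausdorffInvariants

open Filter Topology
open scoped NNReal

section CardinalInvariants

variable {X : Type} {I J F : Set (Set X)} {A : Set X}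

theorem exists_mk_eq_add (h : ∃ F ⊆ I, ⋃₀ F ∉ I) : ∃ F ⊆ I, ⋃₀ F ∉ I ∧ #F = add I := by
  obtain ⟨F, hF, hU⟩ := h
  exact csInf_mem (s := {κ | ∃ F : Set (Set X), F ⊆ I ∧ ⋃₀ F ∉ I ∧ #F = κ}) ⟨#F, F, hF, hU, rfl⟩

theorem exists_mk_eq_cov (h : ⋃₀ I = univ) : ∃ F ⊆ I, ⋃₀ F = univ ∧ #F = cov I :=
  csInf_mem (s := {κ | ∃ F : Set (Set X), F ⊆ I ∧ ⋃₀ F = univ ∧ #F = κ}) ⟨#I, I, subset_rfl, h, rfl⟩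

theorem exists_mk_eq_non (h : I ≠ univ) : ∃ A ∉ I, #A = non I := by
  obtain ⟨A, hA⟩ := (ne_univ_iff_exists_notMem I).1 h
  exact csInf_mem (s := {κ | ∃ A : Set X, A ∉ I ∧ #A = κ}) ⟨#A, A, hA, rfl⟩

theorem add_le (hF : F ⊆ I) (hU : ⋃₀ F ∉ I) : add I ≤ #F :=
  csInf_le' ⟨F, hF, hU, rfl⟩

theorem cov_le (hF : F ⊆ I) (hU : ⋃₀ F = univ) : cov I ≤ #F :=
  csInf_le' ⟨F, hF, hU, rfl⟩

theorem non_le (hA : A ∉ I) : non I ≤ #A :=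
  csInf_le' ⟨A, hA, rfl⟩

theorem cov_le_cov (hIJ : I ⊆ J) (hI : ⋃₀ I = univ) : cov J ≤ cov I := by
  obtain ⟨F, hF, hU, hcard⟩ := exists_mk_eq_cov hI
  exact (cov_le (hF.trans hIJ) hU).trans hcard.le

theorem non_le_non (hIJ : I ⊆ J) (hJ : J ≠ univ) : non I ≤ non J := by
  obtain ⟨A, hA, hcard⟩ := exists_mk_eq_non hJ
  exact (non_le fun h => hA (hIJ h)).trans hcard.le

theorem aleph_one_le_add (hI : ∀ F ⊆ I, F.Countable → ⋃₀ F ∈ I) (h : ∃ F ⊆ I, ⋃₀ F ∉ I) :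
    ℵ₁ ≤ add I := by
  obtain ⟨F, hF, hU, hcard⟩ := exists_mk_eq_add h
  rw [← hcard, Cardinal.aleph_one_le_iff, ← not_le, Cardinal.le_aleph0_iff_set_countable]
  exact fun hc => hU (hI F hF hc)

end CardinalInvariants

section QuasiMeasurePreserving

open ProbabilityTheory unitInterval

theorem continuous_cdf (ν : Measure ℝ) [IsProbabilityMeasure ν] [NullSingletonClass ν] :
    Continuous (cdf ν) := by
  refine continuous_iff_continuousAt.2 fun x => continuousAt_iff_continuous_left'_right'.2
    ⟨?_, continuousWithinAt_Ioi_iff_Ici.2 ((cdf ν).right_continuous x)⟩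
  have no_jump := (cdf ν).measure_singleton x
  rw [measure_cdf, measure_singleton, eq_comm, ENNReal.ofReal_eq_zero, sub_nonpos] at no_jump
  exact (monotone_cdf ν).continuousWithinAt_Iio_iff_leftLim_eq.2
    (((monotone_cdf ν).leftLim_le le_rfl).antisymm no_jump)

theorem measure_setOf_cdf_le (ν : Measure ℝ) [IsProbabilityMeasure ν] [NullSingletonClass ν]
    {a : ℝ} (ha : a ∈ Icc (0 : ℝ) 1) : ν {x | cdf ν x ≤ a} = ENNReal.ofReal a := by
  rcases ha.2.eq_or_lt with rfl | ha1
  · simp [cdf_le_one]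
  have bdd : BddAbove {x | cdf ν x ≤ a} := by
    obtain ⟨b, hb⟩ := ((tendsto_cdf_atTop ν).eventually_const_lt ha1).exists
    exact ⟨b, fun x hx => not_lt.1 fun hbx => (hb.trans_le (monotone_cdf ν hbx.le)).not_ge hx⟩
  rcases {x | cdf ν x ≤ a}.eq_empty_or_nonempty with hempty | hne
  · have ha0 : a ≤ 0 := ge_of_tendsto' (tendsto_cdf_atBot ν) fun x =>
      (not_le.1 (eq_empty_iff_forall_notMem.1 hempty x)).le
    rw [hempty, measure_empty, ENNReal.ofReal_eq_zero.2 ha0]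
  have max_mem := (isClosed_le (continuous_cdf ν) continuous_const).csSup_mem hne bdd
  set b := sSup {x | cdf ν x ≤ a}
  have eq_Iic : {x | cdf ν x ≤ a} = Iic b :=
    Subset.antisymm (fun x hx => le_csSup bdd hx) fun x hx => (monotone_cdf ν hx).trans max_mem
  have cdf_b : a ≤ cdf ν b := by
    refine ge_of_tendsto ((cdf ν).right_continuous b |>.mono Ioi_subset_Ici_self)
      (eventually_mem_nhdsWithin.mono fun x (hx : b < x) => ?_)
    exact (not_le.1 fun hxa => hx.not_ge (le_csSup bdd hxa)).le
  rw [eq_Iic, ← ofReal_cdf, le_antisymm max_mem cdf_b]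

theorem exists_measurePreserving_unitInterval (ν : Measure ℝ) [IsProbabilityMeasure ν]
    [NullSingletonClass ν] : ∃ f : ℝ → I, MeasurePreserving f ν volume := by
  have hm : Measurable fun x => (⟨cdf ν x, cdf_nonneg ν x, cdf_le_one ν x⟩ : I) :=
    (monotone_cdf ν).measurable.subtype_mk
  have := Measure.isProbabilityMeasure_map (μ := ν) hm.aemeasurable
  refine ⟨_, hm, Measure.ext_of_Iic _ _ fun a => ?_⟩
  rw [Measure.map_apply hm measurableSet_Iic, unitInterval.volume_Iic]
  exact measure_setOf_cdf_le ν a.2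

variable {X Y : Type*} [MeasurableSpace X] [StandardBorelSpace X]
  [MeasurableSpace Y] [StandardBorelSpace Y]

theorem exists_measurePreserving (μ : Measure X) [IsProbabilityMeasure μ] [NullSingletonClass μ]
    (ν : Measure Y) [IsProbabilityMeasure ν] : ∃ f : X → Y, MeasurePreserving f μ ν := by
  have : Nonempty Y := nonempty_of_isProbabilityMeasure ν
  have he := measurableEmbedding_embeddingReal X
  have := Measure.isProbabilityMeasure_map (μ := μ) he.measurable.aemeasurable
  have : NullSingletonClass (μ.map (embeddingReal X)) := ⟨fun y => by
    rw [he.map_apply]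
    exact (subsingleton_singleton.preimage he.injective).measure_zero μ⟩
  obtain ⟨f, hf⟩ := exists_measurePreserving_unitInterval (μ.map (embeddingReal X))
  obtain ⟨g, hg, hgν⟩ := Measure.exists_measurable_map_eq ν
  exact ⟨g ∘ f ∘ embeddingReal X, .comp ⟨hg, hgν⟩ (hf.comp ⟨he.measurable, rfl⟩)⟩

theorem exists_quasiMeasurePreserving (μ : Measure X) [SFinite μ] [NullSingletonClass μ]
    (ν : Measure Y) [SFinite ν] [NeZero ν] :
    ∃ f : X → Y, Measure.QuasiMeasurePreserving f μ ν := by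
  rcases eq_or_ne μ 0 with rfl | hμ
  · obtain ⟨y, -⟩ := nonempty_of_measure_ne_zero (NeZero.ne (ν univ))
    exact ⟨fun _ => y, measurable_const, by simp⟩
  have : NeZero μ := ⟨hμ⟩
  have : NullSingletonClass μ.toFinite :=
    ⟨fun x => toFinite_absolutelyContinuous μ (measure_singleton x)⟩
  obtain ⟨f, hf⟩ := exists_measurePreserving μ.toFinite ν.toFinite
  exact ⟨f, hf.quasiMeasurePreserving.mono (absolutelyContinuous_toFinite μ)
    (toFinite_absolutelyContinuous ν)⟩

end QuasiMeasurePreserving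

section Ideals

variable {X : Type*} [MeasurableSpace X] {μ : Measure X}

/-- The ideal of the sets of outer `μ`-measure zero, measurable or not. -/
def nullSets (μ : Measure X) : Set (Set X) :=
  {A | μ A = 0}

/-- The `σ`-ideal generated by the sets of finite outer `μ`-measure, measurable or not. -/
def sigmaFiniteSets (μ : Measure X) : Set (Set X) :=
  {A | ∃ S : ℕ → Set X, ⋃ k, S k = A ∧ ∀ k, μ (S k) < ∞}

theorem mem_sigmaFiniteSets_of_lt_top {A : Set X} (hA : μ A < ∞) : A ∈ sigmaFiniteSets μ :=
  ⟨fun _ => A, iUnion_const A, fun _ => hA⟩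

theorem nullSets_subset_sigmaFiniteSets : nullSets μ ⊆ sigmaFiniteSets μ := fun _ hA =>
  mem_sigmaFiniteSets_of_lt_top (hA.trans_lt ENNReal.zero_lt_top)

theorem sUnion_nullSets_eq_univ [NullSingletonClass μ] : ⋃₀ nullSets μ = univ :=
  eq_univ_of_forall fun x => ⟨{x}, measure_singleton x, rfl⟩

theorem iUnion_mem_sigmaFiniteSets {A : ℕ → Set X} (hA : ∀ k, A k ∈ sigmaFiniteSets μ) :
    ⋃ k, A k ∈ sigmaFiniteSets μ := by
  choose S hS hfin using hA
  exact ⟨fun k => S k.unpair.1 k.unpair.2, (iUnion_unpair S).trans (iUnion_congr hS),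
    fun k => hfin _ _⟩

theorem sUnion_mem_sigmaFiniteSets {F : Set (Set X)} (hF : F ⊆ sigmaFiniteSets μ)
    (hc : F.Countable) : ⋃₀ F ∈ sigmaFiniteSets μ := by
  rcases F.eq_empty_or_nonempty with rfl | hne
  · exact mem_sigmaFiniteSets_of_lt_top (by simp)
  · obtain ⟨A, rfl⟩ := hc.exists_eq_range hne
    rw [sUnion_range]
    exact iUnion_mem_sigmaFiniteSets fun k => hF (mem_range_self k)

theorem exists_measurableSet_superset {A : Set X} (hA : A ∈ sigmaFiniteSets μ) :
    ∃ B ∈ sigmaFiniteSets μ, MeasurableSet B ∧ A ⊆ B := by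
  obtain ⟨S, rfl, hfin⟩ := hA
  exact ⟨⋃ k, toMeasurable μ (S k),
    ⟨_, rfl, fun k => (measure_toMeasurable (S k)).trans_lt (hfin k)⟩,
    .iUnion fun k => measurableSet_toMeasurable μ (S k),
    iUnion_mono fun k => subset_toMeasurable μ (S k)⟩

theorem sFinite_restrict {A : Set X} (hA : A ∈ sigmaFiniteSets μ) : SFinite (μ.restrict A) := by
  obtain ⟨S, rfl, hfin⟩ := hA
  have (k : ℕ) : IsFiniteMeasure (μ.restrict (S k)) := isFiniteMeasure_restrict.2 (hfin k).ne
  exact sFinite_of_absolutelyContinuous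
    (Measure.absolutelyContinuous_of_le Measure.restrict_iUnion_le)

theorem countable_setOf_subset {ι : Type*} {C : ι → Set X} (hm : ∀ i, MeasurableSet (C i))
    (hd : Pairwise (Function.onFun Disjoint C)) (hpos : ∀ i, 0 < μ (C i)) {A : Set X}
    (hA : A ∈ sigmaFiniteSets μ) : {i | C i ⊆ A}.Countable := by
  have := sFinite_restrict hA
  refine (Measure.countable_meas_pos_of_disjoint_iUnion (μ := μ.restrict A) hm hd).mono
    fun i (hi : C i ⊆ A) => ?_
  exact (hpos i).trans_eq (Measure.restrict_eq_self μ hi).symm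

theorem exists_preimage_inter_null [StandardBorelSpace X] [NullSingletonClass μ] {Y : Type*}
    [MeasurableSpace Y] [StandardBorelSpace Y] (ν : Measure Y) [SFinite ν] [NeZero ν] {A : Set X}
    (hA : A ∈ sigmaFiniteSets μ) :
    ∃ f : X → Y, ∀ N, ν N = 0 → μ (f ⁻¹' N ∩ A) = 0 := by
  have := sFinite_restrict hA
  obtain ⟨f, hf⟩ := exists_quasiMeasurePreserving (μ.restrict A) ν
  exact ⟨f, fun N hN => le_zero_iff.1
    ((Measure.le_restrict_apply _ _).trans (hf.preimage_null hN).le)⟩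

end Ideals

section AddCof

variable {X ι : Type} [MeasurableSpace X] {μ : Measure X} {C : ι → Set X}

theorem add_sigmaFiniteSets [Uncountable ι] (hm : ∀ i, MeasurableSet (C i))
    (hd : Pairwise (Function.onFun Disjoint C)) (hpos : ∀ i, 0 < μ (C i))
    (hfin : ∀ i, μ (C i) < ∞) : add (sigmaFiniteSets μ) = ℵ₁ := by
  obtain ⟨Z, hZ⟩ : ∃ Z : Set ι, #Z = ℵ₁ :=
    Cardinal.le_mk_iff_exists_set.1 (Cardinal.aleph_one_le_iff.2 Cardinal.aleph0_lt_mk)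
  have subset : C '' Z ⊆ sigmaFiniteSets μ :=
    image_subset_iff.2 fun i _ => mem_sigmaFiniteSets_of_lt_top (hfin i)
  have notMem : ⋃₀ (C '' Z) ∉ sigmaFiniteSets μ := fun hmem => by
    have hc : Z.Countable := (countable_setOf_subset hm hd hpos hmem).mono
      fun i hi => subset_sUnion_of_mem (mem_image_of_mem C hi)
    rw [← Cardinal.le_aleph0_iff_set_countable, hZ] at hc
    exact hc.not_gt Cardinal.aleph0_lt_aleph_one
  exact le_antisymm ((add_le subset notMem).trans (Cardinal.mk_image_le.trans hZ.le))
    (aleph_one_le_add (fun _ => sUnion_mem_sigmaFiniteSets) ⟨_, subset, notMem⟩)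

theorem mk_le_cof_sigmaFiniteSets [Uncountable ι] (hm : ∀ i, MeasurableSet (C i))
    (hd : Pairwise (Function.onFun Disjoint C)) (hpos : ∀ i, 0 < μ (C i))
    (hfin : ∀ i, μ (C i) < ∞) : #ι ≤ cof (sigmaFiniteSets μ) := by
  refine Order.le_cof_iff.2 fun s hs => not_lt.1 fun hlt => ?_
  choose g hgs hCg using fun i => hs ⟨C i, mem_sigmaFiniteSets_of_lt_top (hfin i)⟩
  obtain ⟨A, hA⟩ := Cardinal.exists_uncountable_fiber (fun i => (⟨g i, hgs i⟩ : s)) hlt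
  refine hA.not_countable ((countable_setOf_subset hm hd hpos A.1.2).mono ?_)
  rintro i rfl
  exact hCg i

theorem cof_sigmaFiniteSets_le_continuum [MeasurableSpace.CountablyGenerated X] (μ : Measure X) :
    cof (sigmaFiniteSets μ) ≤ 𝔠 := by
  have cofinal : IsCofinal {A : sigmaFiniteSets μ | MeasurableSet (A : Set X)} := fun A => by
    obtain ⟨B, hB, hBm, hAB⟩ := exists_measurableSet_superset A.2
    exact ⟨⟨B, hB⟩, hBm, hAB⟩
  have mk_measurableSet : #{A : Set X | MeasurableSet A} ≤ 𝔠 := by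
    rw [← MeasurableSpace.generateFrom_countableGeneratingSet (α := X)]
    exact MeasurableSpace.cardinal_measurableSet_le_continuum
      ((Cardinal.le_aleph0_iff_set_countable.2
        MeasurableSpace.countable_countableGeneratingSet).trans Cardinal.aleph0_le_continuum)
  exact (Order.cof_le cofinal).trans ((Cardinal.mk_preimage_of_injective _ _
    Subtype.val_injective).trans mk_measurableSet)

end AddCof

section CovNon

variable {X : Type} [MeasurableSpace X] [StandardBorelSpace X] {μ : Measure X}
  [NullSingletonClass μ] {ν : Measure X} [SFinite ν] [NeZero ν]

theorem cov_sigmaFiniteSets (hν : sigmaFiniteSets μ ⊆ nullSets ν) :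
    cov (sigmaFiniteSets μ) = cov (nullSets μ) := by
  have sUnion_null := sUnion_nullSets_eq_univ (μ := μ)
  refine (cov_le_cov nullSets_subset_sigmaFiniteSets sUnion_null).antisymm ?_
  obtain ⟨F, hF, hU, hcard⟩ := exists_mk_eq_cov (I := sigmaFiniteSets μ)
    (univ_subset_iff.1 (sUnion_null.ge.trans (sUnion_mono nullSets_subset_sigmaFiniteSets)))
  have infinite : ℵ₀ ≤ #F := by
    refine (not_le.1 fun hc => NeZero.ne (ν univ) (hν ?_)).le
    exact hU ▸ sUnion_mem_sigmaFiniteSets hF (Cardinal.le_aleph0_iff_set_countable.1 hc)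
  choose f hf using fun H : F => exists_preimage_inter_null ν (hF H.2)
  have null : range (fun p : F × F => f p.1 ⁻¹' p.2 ∩ p.1) ⊆ nullSets μ :=
    range_subset_iff.2 fun p => hf p.1 _ (hν (hF p.2.2))
  have covers : ⋃₀ range (fun p : F × F => f p.1 ⁻¹' p.2 ∩ p.1) = univ := by
    refine eq_univ_of_forall fun x => ?_
    obtain ⟨H, hH, hxH⟩ : x ∈ ⋃₀ F := hU ▸ mem_univ x
    obtain ⟨G, hG, hxG⟩ : f ⟨H, hH⟩ x ∈ ⋃₀ F := hU ▸ mem_univ _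
    exact ⟨_, ⟨(⟨H, hH⟩, ⟨G, hG⟩), rfl⟩, hxG, hxH⟩
  calc cov (nullSets μ) ≤ #(F × F) := (cov_le null covers).trans Cardinal.mk_range_le
    _ = cov (sigmaFiniteSets μ) := by
      rw [Cardinal.mk_prod, Cardinal.lift_id, Cardinal.mul_eq_self infinite, hcard]

theorem non_sigmaFiniteSets (hν : sigmaFiniteSets μ ⊆ nullSets ν) :
    non (sigmaFiniteSets μ) = non (nullSets μ) := by
  have subset := nullSets_subset_sigmaFiniteSets (μ := μ)
  have ne_univ : sigmaFiniteSets μ ≠ univ := fun h =>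
    NeZero.ne (ν univ) (hν (h ▸ mem_univ univ))
  refine le_antisymm ?_ (non_le_non subset ne_univ)
  obtain ⟨A, hA, hcard⟩ := exists_mk_eq_non (I := nullSets μ)
    fun h => ne_univ (univ_subset_iff.1 (h.ge.trans subset))
  rw [← hcard]
  by_cases hAσ : A ∈ sigmaFiniteSets μ
  · obtain ⟨f, hf⟩ := exists_preimage_inter_null ν hAσ
    refine (non_le fun himage => hA ?_).trans (Cardinal.mk_image_le (f := f) (s := A))
    exact measure_mono_null (subset_inter (subset_preimage_image f A) subset_rfl)
      (hf _ (hν himage))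
  · exact non_le hAσ

end CovNon

section GeometricCoding

open PiNat

theorem firstDiff_letterwise {α β : Type*} {e : ℕ → β → α} (he : ∀ k, Function.Injective (e k))
    (x y : ℕ → β) : firstDiff (fun k => e k (x k)) (fun k => e k (y k)) = firstDiff x y := by
  classical
  have hiff : (fun k => e k (x k)) ≠ (fun k => e k (y k)) ↔ x ≠ y := by
    simp only [ne_eq, funext_iff, (he _).eq_iff]
  simp only [firstDiff_def, hiff, (he _).ne_iff]

/-- A coding of points of `X` by sequences of letters for which the distance of two points is,
up to the constants `K` and `L`, the power `s ^ k`, where `k` is the first place at which their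
sequences differ. -/
structure IsGeometricCoding {α X : Type*} [MetricSpace X] (s : ℝ) (K L : ℝ≥0)
    (f : (ℕ → α) → X) : Prop where
  dist_le : ∀ x y, dist (f x) (f y) ≤ K * s ^ firstDiff x y
  pow_le : ∀ x y, x ≠ y → s ^ firstDiff x y ≤ L * dist (f x) (f y)

namespace IsGeometricCoding

variable {α β X Y : Type*} [MetricSpace X] [MetricSpace Y] {s : ℝ} {K L : ℝ≥0}
  {f : (ℕ → α) → X}

theorem injective (hf : IsGeometricCoding s K L f) (hs : 0 < s) : Function.Injective f := by
  intro x y hxy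
  by_contra hne
  have h := hf.pow_le x y hne
  rw [hxy, dist_self, mul_zero] at h
  exact h.not_gt (pow_pos hs _)

theorem dist_le_of_eq (hf : IsGeometricCoding s K L f) (hs0 : 0 ≤ s) (hs1 : s ≤ 1) {k : ℕ}
    {x y : ℕ → α} (h : ∀ i < k, x i = y i) : dist (f x) (f y) ≤ K * s ^ k := by
  rcases eq_or_ne x y with rfl | hne
  · rw [dist_self]
    positivity
  have hk : k ≤ firstDiff x y := not_lt.1 fun hlt => apply_firstDiff_ne hne (h _ hlt)
  exact (hf.dist_le x y).trans
    (mul_le_mul_of_nonneg_left (pow_le_pow_of_le_one hs0 hs1 hk) K.coe_nonneg)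

theorem continuous [TopologicalSpace α] [DiscreteTopology α] (hf : IsGeometricCoding s K L f)
    (hs0 : 0 ≤ s) (hs1 : s < 1) : Continuous f := by
  refine continuous_iff_continuousAt.2 fun x => Metric.tendsto_nhds.2 fun ε hε => ?_
  have hlim : Tendsto (fun k : ℕ => K * s ^ k) atTop (𝓝 0) := by
    simpa using (tendsto_pow_atTop_nhds_zero_of_lt_one hs0 hs1).const_mul (K : ℝ)
  obtain ⟨k, hk⟩ := (hlim.eventually_lt_const hε).exists
  filter_upwards [(isOpen_cylinder (fun _ => α) x k).mem_nhds (self_mem_cylinder x k)] with y hy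
  exact (hf.dist_le_of_eq hs0 hs1.le hy).trans_lt hk

theorem comp_bilipschitz (hf : IsGeometricCoding s K L f) {A B : ℝ≥0} {g : X → Y}
    (hg : LipschitzWith A g) (hg' : AntilipschitzWith B g) :
    IsGeometricCoding s (A * K) (L * B) (g ∘ f) where
  dist_le x y := calc
    dist (g (f x)) (g (f y)) ≤ A * dist (f x) (f y) := hg.dist_le_mul _ _
    _ ≤ A * (K * s ^ firstDiff x y) := by gcongr; exact hf.dist_le x y
    _ = ↑(A * K) * s ^ firstDiff x y := by push_cast; ring
  pow_le x y hxy := calc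
    s ^ firstDiff x y ≤ L * dist (f x) (f y) := hf.pow_le x y hxy
    _ ≤ L * (B * dist (g (f x)) (g (f y))) := by gcongr; exact hg'.le_mul_dist _ _
    _ = ↑(L * B) * dist (g (f x)) (g (f y)) := by push_cast; ring

theorem comp_letterwise (hf : IsGeometricCoding s K L f) {e : ℕ → β → α}
    (he : ∀ k, Function.Injective (e k)) :
    IsGeometricCoding s K L fun x : ℕ → β => f fun k => e k (x k) where
  dist_le x y := firstDiff_letterwise he x y ▸ hf.dist_le _ _
  pow_le x y hxy := firstDiff_letterwise he x y ▸ hf.pow_le _ _ fun h =>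
    hxy (funext fun k => he k (congrFun h k))

theorem ediam_image_le (hf : IsGeometricCoding s K L f) (hs0 : 0 ≤ s) (hs1 : s ≤ 1) {k : ℕ}
    (v : Fin k → α) :
    Metric.ediam (f '' {x | ∀ i : Fin k, x i = v i}) ≤ ENNReal.ofReal (K * s ^ k) := by
  refine Metric.ediam_le ?_
  rintro _ ⟨x, hx, rfl⟩ _ ⟨y, hy, rfl⟩
  rw [edist_dist]
  exact ENNReal.ofReal_le_ofReal (hf.dist_le_of_eq hs0 hs1 fun i hi =>
    (hx ⟨i, hi⟩).trans (hy ⟨i, hi⟩).symm)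

theorem sum_ediam_rpow_le [Fintype α] (hf : IsGeometricCoding s K L f) (hs0 : 0 ≤ s)
    (hs1 : s ≤ 1) {r : ℝ} (hr : 0 ≤ r) (hsr : Fintype.card α * s ^ r ≤ 1) (k : ℕ) :
    ∑ v : Fin k → α, Metric.ediam (f '' {x | ∀ i : Fin k, x i = v i}) ^ r ≤
      ENNReal.ofReal ((K : ℝ) ^ r) :=
  calc ∑ v : Fin k → α, Metric.ediam (f '' {x | ∀ i : Fin k, x i = v i}) ^ r
      ≤ ∑ _v : Fin k → α, ENNReal.ofReal ((K * s ^ k) ^ r) := by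
        gcongr with v
        rw [← ENNReal.ofReal_rpow_of_nonneg (by positivity) hr]
        exact ENNReal.rpow_le_rpow (hf.ediam_image_le hs0 hs1 v) hr
    _ = ENNReal.ofReal ((Fintype.card α : ℝ) ^ k * (K * s ^ k) ^ r) := by
        rw [Finset.sum_const, nsmul_eq_mul, ENNReal.ofReal_mul (by positivity)]
        simp [ENNReal.ofReal_pow]
    _ = ENNReal.ofReal ((Fintype.card α * s ^ r) ^ k * K ^ r) := by
        rw [Real.mul_rpow K.coe_nonneg (by positivity), mul_pow, Real.rpow_pow_comm hs0]
        ring_nf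
    _ ≤ ENNReal.ofReal ((K : ℝ) ^ r) := by
        refine ENNReal.ofReal_le_ofReal (mul_le_of_le_one_left (by positivity) ?_)
        exact pow_le_one₀ (by positivity) hsr

theorem holderOnWith_extend (hf : IsGeometricCoding s K L f) (hs : 0 < s) {r : ℝ≥0} {Y : Type*}
    [PseudoMetricSpace Y] {g : (ℕ → α) → Y}
    (hg : ∀ x y, x ≠ y → dist (g x) (g y) ≤ (s ^ (r : ℝ)) ^ firstDiff x y) (e : X → Y) :
    HolderOnWith (L ^ (r : ℝ)) r (Function.extend f g e) (range f) := by
  rintro _ ⟨x, rfl⟩ _ ⟨y, rfl⟩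
  simp only [(hf.injective hs).extend_apply]
  rcases eq_or_ne x y with rfl | hne
  · simp
  have hdist : dist (g x) (g y) ≤ (L * dist (f x) (f y)) ^ (r : ℝ) := by
    refine (hg x y hne).trans ?_
    rw [Real.rpow_pow_comm hs.le]
    exact Real.rpow_le_rpow (by positivity) (hf.pow_le x y hne) r.2
  rw [edist_nndist, edist_nndist, ← ENNReal.coe_rpow_of_nonneg _ r.coe_nonneg, ← ENNReal.coe_mul,
    ENNReal.coe_le_coe, ← NNReal.mul_rpow]
  exact_mod_cast hdist

variable [MeasurableSpace X] [BorelSpace X]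

theorem hausdorffMeasure_range_lt_top [Fintype α] (hf : IsGeometricCoding s K L f) (hs0 : 0 ≤ s)
    (hs1 : s < 1) {r : ℝ} (hr : 0 ≤ r) (hsr : Fintype.card α * s ^ r ≤ 1) :
    μH[r] (range f) < ∞ := by
  have hlim : Tendsto (fun k : ℕ => ENNReal.ofReal (K * s ^ k)) atTop (𝓝 0) := by
    simpa using ENNReal.tendsto_ofReal
      ((tendsto_pow_atTop_nhds_zero_of_lt_one hs0 hs1).const_mul (K : ℝ))
  have covers (k : ℕ) : range f ⊆ ⋃ v : Fin k → α, f '' {x | ∀ i : Fin k, x i = v i} :=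
    range_subset_iff.2 fun x => mem_iUnion.2 ⟨fun i => x i, x, fun _ => rfl, rfl⟩
  refine (Measure.hausdorffMeasure_le_liminf_sum r (range f) (l := atTop) _ hlim _
    (.of_forall fun k => hf.ediam_image_le hs0 hs1.le) (.of_forall covers)).trans_lt ?_
  exact (liminf_le_of_frequently_le' (.of_forall
    (hf.sum_ediam_rpow_le hs0 hs1.le hr hsr))).trans_lt ENNReal.ofReal_lt_top

theorem hausdorffMeasure_range_pos [Fintype α] [Nontrivial α] (hf : IsGeometricCoding s K L f)
    (hs : 0 < s) {r : ℝ} (hr : 0 < r) (hsr : 1 ≤ Fintype.card α * s ^ r) :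
    0 < μH[r] (range f) := by
  lift r to ℝ≥0 using hr.le
  -- Reading a code as an expansion to base `card α` maps `range f` onto `[0, 1]`, and this map is
  -- Hölder continuous with exponent `r`.
  set g : (ℕ → α) → ℝ := fun x => Real.ofDigits fun k => Fintype.equivFin α (x k)
  have hg : ∀ x y, x ≠ y → dist (g x) (g y) ≤ (s ^ (r : ℝ)) ^ firstDiff x y := fun x y _ =>
    calc dist (g x) (g y) ≤ ((Fintype.card α : ℝ) ^ firstDiff x y)⁻¹ :=
        Real.abs_ofDigits_sub_ofDigits_le fun i hi => by rw [apply_eq_of_lt_firstDiff hi]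
      _ ≤ (s ^ (r : ℝ)) ^ firstDiff x y := by
        rw [← inv_pow]
        gcongr
        exact (inv_le_iff_one_le_mul₀' (by positivity)).2 hsr
  have Icc_subset : Icc (0 : ℝ) 1 ⊆ range g := fun t ht => by
    obtain ⟨d, -, rfl⟩ := Real.ofDigits_SurjOn (Fintype.one_lt_card (α := α)) ht
    exact ⟨fun k => (Fintype.equivFin α).symm (d k), by simp [g]⟩
  have range_eq : Function.extend f g 0 '' range f = range g := by
    rw [← range_comp, Function.extend_comp (hf.injective hs)]
  have one_le : (1 : ℝ≥0∞) ≤ μH[1] (range g) := by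
    refine le_trans ?_ (measure_mono Icc_subset)
    simp [hausdorffMeasure_real]
  have image_le := (hf.holderOnWith_extend hs hg 0).hausdorffMeasure_image_le
    (by exact_mod_cast hr) zero_le_one
  refine pos_iff_ne_zero.2 fun h0 => ?_
  rw [range_eq, mul_one, h0, mul_zero] at image_le
  exact (one_le.trans image_le).not_gt zero_lt_one

theorem exists_pairwise_disjoint_measure_pos_lt_top [Fintype α] [Nontrivial α]
    {f : (ℕ → α × β) → X} (hf : IsGeometricCoding s K L f) (hs0 : 0 < s) (hs1 : s < 1) {r : ℝ}
    (hr : 0 < r) (hsr : Fintype.card α * s ^ r = 1) :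
    ∃ C : (ℕ → β) → Set X, (∀ z, MeasurableSet (C z)) ∧ Pairwise (Function.onFun Disjoint C) ∧
      (∀ z, 0 < μH[r] (C z)) ∧ ∀ z, μH[r] (C z) < ∞ := by
  let _ : TopologicalSpace α := ⊥
  have : DiscreteTopology α := ⟨rfl⟩
  have hfibre (z : ℕ → β) : IsGeometricCoding s K L fun w : ℕ → α => f fun k => (w k, z k) :=
    hf.comp_letterwise (e := fun k a => (a, z k)) fun k => Prod.mk_left_injective (z k)
  refine ⟨fun z => range fun w : ℕ → α => f fun k => (w k, z k), fun z => ?_, fun z z' hne => ?_,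
    fun z => (hfibre z).hausdorffMeasure_range_pos hs0 hr hsr.ge,
    fun z => (hfibre z).hausdorffMeasure_range_lt_top hs0.le hs1 hr.le hsr.le⟩
  · exact (isCompact_range ((hfibre z).continuous hs0.le hs1)).measurableSet
  · refine disjoint_left.2 ?_
    rintro _ ⟨w, rfl⟩ ⟨w', hw'⟩
    exact hne (funext fun k => congrArg Prod.snd (congrFun (hf.injective hs0 hw') k).symm)

end IsGeometricCoding

end GeometricCoding

section DigitSum

variable {c : ℕ → ℝ} {B s : ℝ}

theorem norm_mul_pow_le (hc : ∀ i, |c i| ≤ B) (hs0 : 0 ≤ s) (i : ℕ) :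
    ‖c i * s ^ i‖ ≤ B * s ^ i := by
  rw [norm_mul, Real.norm_eq_abs, Real.norm_of_nonneg (pow_nonneg hs0 i)]
  exact mul_le_mul_of_nonneg_right (hc i) (pow_nonneg hs0 i)

theorem summable_mul_pow_of_abs_le (hc : ∀ i, |c i| ≤ B) (hs0 : 0 ≤ s) (hs1 : s < 1) :
    Summable fun i => c i * s ^ i :=
  .of_norm_bounded ((summable_geometric_of_lt_one hs0 hs1).mul_left B) (norm_mul_pow_le hc hs0)

theorem abs_tsum_mul_pow_le (hc : ∀ i, |c i| ≤ B) (hs0 : 0 ≤ s) (hs : s ≤ 1 / 2) :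
    |∑' i, c i * s ^ i| ≤ 2 * B := by
  have hB : 0 ≤ B := (abs_nonneg _).trans (hc 0)
  have hinv : (1 - s)⁻¹ ≤ 2 := by
    rw [inv_le_comm₀ (by linarith) two_pos]
    linarith
  calc ‖∑' i, c i * s ^ i‖ ≤ B * (1 - s)⁻¹ :=
        tsum_of_norm_bounded ((hasSum_geometric_of_lt_one hs0 (by linarith)).mul_left B)
          (norm_mul_pow_le hc hs0)
    _ ≤ 2 * B := by rw [mul_comm]; gcongr

theorem half_le_abs_tsum_mul_pow (hc : ∀ i, |c i| ≤ B) (h0 : 1 ≤ |c 0|) (hs0 : 0 ≤ s)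
    (hs : 4 * B * s ≤ 1) : 1 / 2 ≤ |∑' i, c i * s ^ i| := by
  have hs2 : s ≤ 1 / 2 := by nlinarith [h0.trans (hc 0)]
  have tail : |∑' i, c (i + 1) * s ^ i| ≤ 2 * B :=
    abs_tsum_mul_pow_le (fun i => hc (i + 1)) hs0 hs2
  have split : ∑' i, c i * s ^ i = c 0 + s * ∑' i, c (i + 1) * s ^ i := by
    rw [(summable_mul_pow_of_abs_le hc hs0 (by linarith)).tsum_eq_zero_add, ← tsum_mul_left]
    simp only [pow_zero, mul_one, pow_succ', mul_left_comm]
  have htri := abs_sub_abs_le_abs_add (c 0) (s * ∑' i, c (i + 1) * s ^ i)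
  rw [abs_mul, abs_of_nonneg hs0] at htri
  rw [split]
  nlinarith

theorem tsum_mul_pow_eq_pow_mul_tsum (hc : ∀ i, |c i| ≤ B) (hs0 : 0 ≤ s) (hs1 : s < 1) {k : ℕ}
    (h0 : ∀ i < k, c i = 0) : ∑' i, c i * s ^ i = s ^ k * ∑' i, c (i + k) * s ^ i := by
  rw [← (summable_mul_pow_of_abs_le hc hs0 hs1).sum_add_tsum_nat_add k,
    Finset.sum_eq_zero fun i hi => by rw [h0 i (Finset.mem_range.1 hi), zero_mul], zero_add,
    ← tsum_mul_left]
  simp only [pow_add, mul_comm, mul_left_comm]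

variable {D : ℕ} {a b : ℕ → Fin D}

/-- The number `∑ aₖ sᵏ` with digits `aₖ < D`. It is used for `s` small compared with `1 / D`, where
distinct digit sequences give separated numbers. -/
noncomputable def digitSum (s : ℝ) (a : ℕ → Fin D) : ℝ :=
  ∑' k, (a k : ℝ) * s ^ k

theorem abs_digit_sub_le (x y : Fin D) : |(x : ℝ) - y| ≤ D :=
  abs_sub_le_of_nonneg_of_le x.val.cast_nonneg (mod_cast x.is_lt.le) y.val.cast_nonneg
    (mod_cast y.is_lt.le)

theorem one_le_abs_digit_sub {x y : Fin D} (h : x ≠ y) : 1 ≤ |(x : ℝ) - y| := by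
  have : (1 : ℤ) ≤ |(x : ℤ) - y| :=
    Int.one_le_abs (sub_ne_zero.2 (Nat.cast_injective.ne (Fin.val_ne_of_ne h)))
  exact_mod_cast this

theorem le_half_of_four_mul_digits_mul_le (a : Fin D) (hs : 4 * D * s ≤ 1) :
    s ≤ 1 / 2 := by
  have : (1 : ℝ) ≤ D := mod_cast a.pos
  nlinarith

theorem digitSum_sub_digitSum (hs0 : 0 ≤ s) (hs : 4 * D * s ≤ 1) {k : ℕ}
    (h : ∀ i < k, a i = b i) :
    digitSum s a - digitSum s b = s ^ k * ∑' i, ((a (i + k) : ℝ) - b (i + k)) * s ^ i := by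
  have hs1 : s < 1 := (le_half_of_four_mul_digits_mul_le (a 0) hs).trans_lt (by norm_num)
  have hsum (a : ℕ → Fin D) : Summable fun i => (a i : ℝ) * s ^ i :=
    summable_mul_pow_of_abs_le (B := D)
      (fun i => by rw [Nat.abs_cast]; exact_mod_cast (a i).is_lt.le) hs0 hs1
  rw [digitSum, digitSum, ← (hsum a).tsum_sub (hsum b)]
  simp only [← sub_mul]
  exact tsum_mul_pow_eq_pow_mul_tsum (fun i => abs_digit_sub_le (a i) (b i)) hs0 hs1
    fun i hi => by rw [h i hi, sub_self]

theorem abs_digitSum_sub_le (hs0 : 0 ≤ s) (hs : 4 * D * s ≤ 1) {k : ℕ} (h : ∀ i < k, a i = b i) :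
    |digitSum s a - digitSum s b| ≤ 2 * D * s ^ k := by
  rw [digitSum_sub_digitSum hs0 hs h, abs_mul, abs_of_nonneg (pow_nonneg hs0 k), mul_comm]
  gcongr
  exact abs_tsum_mul_pow_le (fun i => abs_digit_sub_le _ _) hs0
    (le_half_of_four_mul_digits_mul_le (a 0) hs)

theorem pow_le_two_mul_abs_digitSum_sub (hs0 : 0 ≤ s) (hs : 4 * D * s ≤ 1) {k : ℕ}
    (h : ∀ i < k, a i = b i) (hk : a k ≠ b k) : s ^ k ≤ 2 * |digitSum s a - digitSum s b| := by
  have half_le : 1 / 2 ≤ |∑' i, ((a (i + k) : ℝ) - b (i + k)) * s ^ i| :=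
    half_le_abs_tsum_mul_pow (fun i => abs_digit_sub_le _ _)
      (one_le_abs_digit_sub (by rwa [zero_add])) hs0 hs
  rw [digitSum_sub_digitSum hs0 hs h, abs_mul, abs_of_nonneg (pow_nonneg hs0 k)]
  nlinarith [pow_nonneg hs0 k]

theorem isGeometricCoding_digitSum {ι : Type*} [Fintype ι] (hs0 : 0 ≤ s) (hs : 4 * D * s ≤ 1) :
    IsGeometricCoding s (2 * D) 2
      fun (x : ℕ → ι → Fin D) (j : ι) => digitSum s fun k => x k j where
  dist_le x y := (dist_pi_le_iff (by positivity)).2 fun j => by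
    push_cast
    exact abs_digitSum_sub_le hs0 hs fun i hi => by rw [PiNat.apply_eq_of_lt_firstDiff hi]
  pow_le x y hne := by
    obtain ⟨j, hj⟩ := Function.ne_iff.1 (PiNat.apply_firstDiff_ne hne)
    calc s ^ PiNat.firstDiff x y
        ≤ 2 * dist (digitSum s fun k => x k j) (digitSum s fun k => y k j) :=
          pow_le_two_mul_abs_digitSum_sub hs0 hs
            (fun i hi => by rw [PiNat.apply_eq_of_lt_firstDiff hi]) hj
      _ ≤ _ := by
          push_cast
          gcongr
          exact dist_le_pi_dist (fun j => digitSum s fun k => x k j)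
            (fun j => digitSum s fun k => y k j) j

end DigitSum

section FiniteDimensional

theorem exists_pow_mul_rpow_eq_one {d : ℕ} {r ε : ℝ} (hr : 0 < r) (hrd : r < d) (hε : 0 < ε) :
    ∃ M : ℕ, 2 ≤ M ∧ ∃ s : ℝ, 0 < s ∧ M * s ≤ ε ∧ (M : ℝ) ^ d * s ^ r = 1 := by
  have hlim : Tendsto (fun M : ℕ => (M : ℝ) ^ (-(d / r - 1))) atTop (𝓝 0) :=
    (tendsto_rpow_neg_atTop (sub_pos.2 ((one_lt_div hr).2 hrd))).comp tendsto_natCast_atTop_atTop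
  obtain ⟨M, hMε, hM2⟩ := ((hlim.eventually_le_const hε).and (eventually_ge_atTop 2)).exists
  have hM : (0 : ℝ) < M := by positivity
  refine ⟨M, hM2, (M : ℝ) ^ (-(d / r)), Real.rpow_pos_of_pos hM _, ?_, ?_⟩
  · rwa [← Real.rpow_one_add' hM.le (by linarith [(one_lt_div hr).2 hrd]), ← sub_eq_add_neg,
      ← neg_sub]
  · rw [← Real.rpow_mul hM.le, neg_mul, div_mul_cancel₀ _ hr.ne', Real.rpow_neg hM.le,
      Real.rpow_natCast, mul_inv_cancel₀ (by positivity)]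

theorem injective_finProdFinEquiv_diag {ι : Type*} [Nonempty ι] (M N : ℕ) :
    Function.Injective fun (p : (ι → Fin M) × Fin N) (j : ι) => finProdFinEquiv (p.1 j, p.2) := by
  rintro ⟨v, a⟩ ⟨w, b⟩ h
  have hj (j : ι) : v j = w j ∧ a = b :=
    Prod.mk.inj (finProdFinEquiv.injective (congrFun h j))
  exact Prod.ext (funext fun j => (hj j).1) (hj (Classical.arbitrary ι)).2

variable {E : Type*} [NormedAddCommGroup E] [NormedSpace ℝ E] [FiniteDimensional ℝ E]
  [MeasurableSpace E] [BorelSpace E] {r : ℝ}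

theorem exists_pairwise_disjoint_hausdorffMeasure_pos_lt_top (hr : 0 < r)
    (hrE : r < Module.finrank ℝ E) :
    ∃ C : (ℕ → Fin 2) → Set E, (∀ z, MeasurableSet (C z)) ∧
      Pairwise (Function.onFun Disjoint C) ∧ (∀ z, 0 < μH[r] (C z)) ∧ ∀ z, μH[r] (C z) < ∞ := by
  set d := Module.finrank ℝ E
  have : NeZero d := ⟨by rintro h; rw [h, Nat.cast_zero] at hrE; exact hr.not_gt hrE⟩
  obtain ⟨M, hM, s, hs0, hMs, hsr⟩ := exists_pow_mul_rpow_eq_one hr hrE (ε := 1 / 8) (by norm_num)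
  have : Nontrivial (Fin M) := Fin.nontrivial_iff_two_le.2 hM
  have hs : 4 * ((M * 2 : ℕ) : ℝ) * s ≤ 1 := by push_cast; linarith
  have hs1 : s < 1 := by nlinarith [(show (2 : ℝ) ≤ M from mod_cast hM)]
  let e : (Fin d → ℝ) ≃L[ℝ] E := .ofFinrankEq (by simp [d])
  have coding := ((isGeometricCoding_digitSum (ι := Fin d) hs0.le hs).comp_bilipschitz
    e.lipschitz e.antilipschitz).comp_letterwise fun _ => injective_finProdFinEquiv_diag M 2
  exact coding.exists_pairwise_disjoint_measure_pos_lt_top hs0 hs1 hr (by simpa using hsr)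

end FiniteDimensional

theorem sigmaFiniteSets_hausdorffMeasure_subset_nullSets {X : Type*} [EMetricSpace X]
    [MeasurableSpace X] [BorelSpace X] {r d : ℝ} (hrd : r < d) :
    sigmaFiniteSets (μH[r] : Measure X) ⊆ nullSets μH[d] := by
  rintro _ ⟨S, rfl, hfin⟩
  exact measure_iUnion_null fun k =>
    (Measure.hausdorffMeasure_zero_or_top hrd (S k)).resolve_right (hfin k).ne

end HausdorffInvariants

open HausdorffInvariants in
theorem mainTheorem7_general {E : Type} [NormedAddCommGroup E] [NormedSpace ℝ E]
    [FiniteDimensional ℝ E] [MeasurableSpace E] [BorelSpace E] {r : ℝ} (hr : 0 < r)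
    (hrE : r < Module.finrank ℝ E) :
    add (sigmaFiniteSets (μH[r] : Measure E)) = ℵ₁ ∧
    cov (sigmaFiniteSets (μH[r] : Measure E)) = cov (nullSets (μH[r] : Measure E)) ∧
    non (sigmaFiniteSets (μH[r] : Measure E)) = non (nullSets (μH[r] : Measure E)) ∧
    cof (sigmaFiniteSets (μH[r] : Measure E)) = 𝔠 := by
  have : ProperSpace E := FiniteDimensional.proper_real E
  have : NullSingletonClass (μH[r] : Measure E) := Measure.nullSingletonClass_hausdorff E hr
  have haar : (μH[Module.finrank ℝ E] : Measure E).IsAddHaarMeasure :=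
    isAddHaarMeasure_hausdorffMeasure
  have null := sigmaFiniteSets_hausdorffMeasure_subset_nullSets (X := E) hrE
  obtain ⟨C, hm, hd, hpos, hfin⟩ := exists_pairwise_disjoint_hausdorffMeasure_pos_lt_top hr hrE
  have mk_index : #(ℕ → Fin 2) = 𝔠 := by simp
  have : Uncountable (ℕ → Fin 2) :=
    Cardinal.aleph0_lt_mk_iff.1 (mk_index ▸ Cardinal.aleph0_lt_continuum)
  exact ⟨add_sigmaFiniteSets hm hd hpos hfin, cov_sigmaFiniteSets null, non_sigmaFiniteSets null,
    (cof_sigmaFiniteSets_le_continuum μH[r]).antisymm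
      (mk_index.ge.trans (mk_le_cof_sigmaFiniteSets hm hd hpos hfin))⟩

theorem mainTheorem7 (n : ℕ) (r : ℝ) (hr : 0 < r) (hrn : r < (n : ℝ)) :
    HausdorffInvariants.add (HausdorffInvariants.sigmaFinIdeal n r) = ℵ₁ ∧
    HausdorffInvariants.cov (HausdorffInvariants.sigmaFinIdeal n r) =
      HausdorffInvariants.cov (HausdorffInvariants.nullIdeal n r) ∧
    HausdorffInvariants.non (HausdorffInvariants.sigmaFinIdeal n r) =
      HausdorffInvariants.non (HausdorffInvariants.nullIdeal n r) ∧
    HausdorffInvariants.cof (HausdorffInvariants.sigmaFinIdeal n r) = 𝔠 :=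
  mainTheorem7_general (E := EuclideanSpace ℝ (Fin n)) hr (by simpa using hrn)
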